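/- Consider a bandit with $K\ge 1$ arms. In slot $t=1,2,\dots$ arm $k$ has a nominal reward $X_{k,t}\in[0,1]$, and there is a load $L_t\in[0,1]$. The loads $(L_t)_t$ are i.i.d. with an arbitrary (e.g. continuous) distribution. The rewards $X_{k,t}$ are independent across arms and slots, identically distributed over $t$ for each $k$ with mean $u_k=\mathbb E[X_{k,t}]$, and independent of the loads. There is a unique best arm $k^*$; for $k\ne k^*$ put $\Delta_k=u_{k^*}-u_k>0$. In slot $t$ the agent observes $L_t$, then pulls an arm $a_t=\Gamma_t(L_t,\mathcal H_{t-1})$, where $\mathcal H_{t-1}=(L_1,a_1,X_{a_1,1},\dots,L_{t-1},a_{t-1},X_{a_{t-1},t-1})$ and $\Gamma_t$ is measurable, observes $X_{a_t,t}$ and receives $L_tX_{a_t,t}$. Let $C_k(t)=\#\{\tau\le t: a_\tau=k\}$, and let $\bar u_k(t)=\frac1{C_k(t-1)}\sum_{\tau<t}\mathbf 1(a_\tau=k)X_{k,\tau}$. The regret is $R(T)=u_{k^*}\,\mathbb E\big[\sum_{t\le T}L_t\big]-\sum_{t\le T}\mathbb E[L_tX_{a_t,t}]$. Given $\alpha>2$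 and thresholds $l^{(-)}\le l^{(+)}$, put $\tilde L_t=\dfrac{\max\{l^{(-)},\min(L_t,l^{(+)})\}-l^{(-)}}{l^{(+)}-l^{(-)}}$ if $l^{(-)}<l^{(+)}$; if $l^{(-)}=l^{(+)}$, put $\tilde L_t=0$ when $L_t\le l^{(-)}$ and $\tilde L_t=1$ when $L_t>l^{(-)}$. AdaUCB pulls each arm once in the first $K$ slots, and in each slot $t>K$ it pulls an arm maximizing $$\hat u_k(t)=\bar u_k(t)+\sqrt{\frac{\alpha(1-\tilde L_t)\log t}{C_k(t-1)}},$$ ties being broken arbitrarily. Suppose that $\mathbb P(L_t\le l^{(-)})=\rho>0$. Then for every $k\neq k^*$ and all $T\ge 1$, $$\mathbb E[C_k(T)]\le\frac{4\alpha\log T}{\Delta_k^2}+O(1),$$ where the $O(1)$ term is bounded by a constant that depends only on $K$, $\alpha$, $\rho$ and $(u_j)_j$, and not on $T$. In particular, AdaUCB has logarithmic regret: $R(T)=O(\log T)$ as $T\to\infty$. -/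

import Mathlib

open MeasureTheory ProbabilityTheory Filter Asymptotics

noncomputable section

namespace OpportunisticBandit

/-- What the agent has seen of one slot: the load, the arm pulled, and the nominal reward of that
arm in that slot. -/
abbrev Obs (K : ℕ) : Type := ℝ × Fin K × ℝ

/-- A (deterministic) policy. Slots are numbered from `0`, so that index `s : ℕ` stands for
slot `t = s + 1`. In slot `s` the policy maps the history of the `s` previous slots and the load of
the present slot to the arm that is pulled: `a_t = Γ(L_t, H_{t-1})`. -/
abbrev Policy (K : ℕ) : Type := ∀ s : ℕ, (Fin s → Obs K) → ℝ → Fin K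

/-- The number of pulls of arm `k` in a history. -/
def pullsIn {K s : ℕ} (h : Fin s → Obs K) (k : Fin K) : ℕ :=
  (Finset.univ.filter fun i => (h i).2.1 = k).card

/-- The average observed nominal reward of arm `k` in a history. -/
def empMean {K s : ℕ} (h : Fin s → Obs K) (k : Fin K) : ℝ :=
  (∑ i, if (h i).2.1 = k then (h i).2.2 else 0) / (pullsIn h k : ℝ)

/-- The load normalized with lower threshold `lm` and upper threshold `lp`. -/
def normLoad (lm lp l : ℝ) : ℝ :=
  if lm = lp then (if l ≤ lm then 0 else 1)
  else (max lm (min l lp) - lm) / (lp - lm)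

/-- The AdaUCB index of arm `k` in slot number `t = s + 1`, after the history `h` of the `s`
previous slots and when the present load is `l`. -/
def ucbIndex {K s : ℕ} (α lm lp : ℝ) (h : Fin s → Obs K) (l : ℝ) (k : Fin K) : ℝ :=
  empMean h k +
    Real.sqrt (α * (1 - normLoad lm lp l) * Real.log ((s : ℝ) + 1) / (pullsIn h k : ℝ))

/-- `Γ` is an AdaUCB policy with exploration parameter `α` and thresholds `lm`, `lp`: in each of
the first `K` slots it pulls an arm that has not been pulled before (so that each arm is
pulled once), and afterwards it pulls an arm with the largest index. The order of the
first `K` pulls and the way of breaking ties are arbitrary (but measurable). -/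
structure IsAdaUCB {K : ℕ} (α lm lp : ℝ) (Γ : Policy K) : Prop where
  measurable : ∀ s, Measurable fun p : (Fin s → Obs K) × ℝ => Γ s p.1 p.2
  init : ∀ s, s < K → ∀ (h : Fin s → Obs K) (l : ℝ), pullsIn h (Γ s h l) = 0
  argmax : ∀ s, K ≤ s → ∀ (h : Fin s → Obs K) (l : ℝ) (k : Fin K),
    ucbIndex α lm lp h l k ≤ ucbIndex α lm lp h l (Γ s h l)

/-- The history of the first `s` slots when the policy `Γ` is run on the load sequence `l` and the
nominal rewards `x`. -/
def history {K : ℕ} (Γ : Policy K) (l : ℕ → ℝ) (x : Fin K → ℕ → ℝ) : ∀ s : ℕ, Fin s → Obs K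
  | 0 => Fin.elim0
  | s + 1 =>
    let h := history Γ l x s
    let a := Γ s h (l s)
    Fin.snoc (α := fun _ => Obs K) h (l s, a, x a s)

/-- The arm pulled in slot `s` when the policy `Γ` is run on the load sequence `l` and the nominal
rewards `x`. -/
def action {K : ℕ} (Γ : Policy K) (l : ℕ → ℝ) (x : Fin K → ℕ → ℝ) (s : ℕ) : Fin K :=
  Γ s (history Γ l x s) (l s)

/-- `C_k(T)`: the number of pulls of arm `k` in the first `T` slots. -/
def pulls {K : ℕ} (Γ : Policy K) (l : ℕ → ℝ) (x : Fin K → ℕ → ℝ) (k : Fin K) (T : ℕ) : ℕ :=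
  ((Finset.range T).filter fun s => action Γ l x s = k).card

/-- The opportunistic bandit with random load and random rewards: `L s` and `X k s` are the load
and the nominal reward of arm `k` in slot `s`. The loads are i.i.d. in `[0,1]`; the rewards lie
in `[0,1]`, are independent across arms and slots, and those of arm `k` are identically distributed
with mean `u k`; the loads are independent of the rewards. -/
structure IsOpportunisticBandit {Ω : Type*} [MeasurableSpace Ω] (μ : Measure Ω) {K : ℕ}
    (L : ℕ → Ω → ℝ) (X : Fin K → ℕ → Ω → ℝ) (u : Fin K → ℝ) : Prop where
  measurable_load : ∀ s, Measurable (L s)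
  measurable_reward : ∀ k s, Measurable (X k s)
  load_mem : ∀ s, ∀ᵐ ω ∂μ, L s ω ∈ Set.Icc (0 : ℝ) 1
  reward_mem : ∀ k s, ∀ᵐ ω ∂μ, X k s ω ∈ Set.Icc (0 : ℝ) 1
  load_ident : ∀ s, IdentDistrib (L s) (L 0) μ μ
  reward_ident : ∀ k s, IdentDistrib (X k s) (X k 0) μ μ
  reward_mean : ∀ k s, ∫ ω, X k s ω ∂μ = u k
  load_indep : iIndepFun L μ
  reward_indep : iIndepFun (fun p : Fin K × ℕ => X p.1 p.2) μ
  load_reward_indep :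
    IndepFun (fun ω (s : ℕ) => L s ω) (fun ω (p : Fin K × ℕ) => X p.1 p.2 ω) μ

/-- `E[C_k(T)]`: the expected number of pulls of arm `k` in the first `T` slots. -/
def expPulls {Ω : Type*} [MeasurableSpace Ω] (μ : Measure Ω) {K : ℕ} (Γ : Policy K)
    (L : ℕ → Ω → ℝ) (X : Fin K → ℕ → Ω → ℝ) (k : Fin K) (T : ℕ) : ℝ :=
  ∫ ω, (pulls Γ (fun s => L s ω) (fun j s => X j s ω) k T : ℝ) ∂μ

/-- The regret of the policy `Γ` over the first `T` slots: the best mean nominal reward times the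
expected total load, minus the expected total actual reward. -/
def regret {Ω : Type*} [MeasurableSpace Ω] (μ : Measure Ω) {K : ℕ} (Γ : Policy K)
    (L : ℕ → Ω → ℝ) (X : Fin K → ℕ → Ω → ℝ) (u : Fin K → ℝ) (T : ℕ) : ℝ :=
  (⨆ k, u k) * (∫ ω, ∑ s ∈ Finset.range T, L s ω ∂μ) -
    ∑ s ∈ Finset.range T,
      ∫ ω, L s ω * X (action Γ (fun r => L r ω) (fun j r => X j r ω) s) s ω ∂μ

end OpportunisticBandit

end

open OpportunisticBandit

open OpportunisticBandit

/-! At high load the exploration bonus may vanish, so the usual optimism argument, in which the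
index of the best arm stays above its mean, fails. What replaces it is accuracy: the best arm must
have been pulled at least of order log t times, so that its empirical mean alone is reliable. The
low-load slots provide this. There the index is the plain UCB index, and they have frequency ρ > 0.

Concentration. For each arm, exp(t(S - uC) - t²C/8) is a supermartingale, S being the collected
reward and C the number of pulls (`lintegral_exp_rewardSum_le`). Markov's inequality bounds
deviations of the empirical mean on {C ≥ n} without a union bound over C.

Exploration. In the window [s/2, s) there are typically at least ρs/4 low-load slots. Unless an
index errs, a low-load slot pulls the best arm or a suboptimal arm still short of O(log s) pulls
(`card_lowLoad_le`). Linear growth beats the logarithm, so the best arm has more than c log(s+1)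
pulls except with summable probability (`exists_summable_measureReal_pulls_le`).

Conclusion. Once arm k has 4α log T / Δ² pulls, its bonus is at most Δ/2 at every load. A further
pull then needs arm k to look Δ/4 too good, the best arm to look Δ/4 too bad, or the best arm to be
underexplored. These events contribute O(1) in expectation (`exists_expPulls_le`). The regret is a
combination of the gaps whose weights are bounded by the expected pulls. -/

namespace OpportunisticBandit

/-- The total nominal reward collected from arm `k` in the first `T` slots. -/
noncomputable def rewardSum {K : ℕ} (Γ : Policy K) (l : ℕ → ℝ) (x : Fin K → ℕ → ℝ) (k : Fin K)
    (T : ℕ) : ℝ :=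
  ∑ s ∈ Finset.range T, if action Γ l x s = k then x k s else 0

/-! ### Pathwise facts: causality, pull counts, index comparisons -/

section Deterministic

variable {K : ℕ} {Γ : Policy K} {l : ℕ → ℝ} {x : Fin K → ℕ → ℝ}

lemma pulls_eq_sum (k : Fin K) (T : ℕ) :
    pulls Γ l x k T = ∑ s ∈ Finset.range T, if action Γ l x s = k then 1 else 0 := by
  rw [pulls, Finset.card_filter]

lemma pulls_succ (k : Fin K) (T : ℕ) :
    pulls Γ l x k (T + 1) = pulls Γ l x k T + if action Γ l x T = k then 1 else 0 := by
  simp only [pulls_eq_sum, Finset.sum_range_succ]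

lemma rewardSum_succ (k : Fin K) (T : ℕ) :
    rewardSum Γ l x k (T + 1) = rewardSum Γ l x k T + if action Γ l x T = k then x k T else 0 := by
  simp only [rewardSum, Finset.sum_range_succ]

lemma history_succ (s : ℕ) :
    history Γ l x (s + 1) =
      Fin.snoc (α := fun _ => Obs K) (history Γ l x s)
        (l s, action Γ l x s, x (action Γ l x s) s) := rfl

lemma pullsIn_history (k : Fin K) (s : ℕ) : pullsIn (history Γ l x s) k = pulls Γ l x k s := by
  induction s with
  | zero => simp [pullsIn, pulls]
  | succ s ih =>
    rw [pulls_succ, ← ih, history_succ]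
    simp only [pullsIn, Finset.card_filter, Fin.sum_univ_castSucc, Fin.snoc_castSucc,
      Fin.snoc_last]

lemma sum_history (k : Fin K) (s : ℕ) :
    (∑ i, if (history Γ l x s i).2.1 = k then (history Γ l x s i).2.2 else 0)
      = rewardSum Γ l x k s := by
  induction s with
  | zero => simp [rewardSum]
  | succ s ih =>
    rw [rewardSum_succ, ← ih, history_succ]
    simp only [Fin.sum_univ_castSucc, Fin.snoc_castSucc, Fin.snoc_last]
    congr 1
    split_ifs with h
    · rw [h]
    · rfl

lemma ucbIndex_history (α lm lp : ℝ) (k : Fin K) (s : ℕ) :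
    ucbIndex α lm lp (history Γ l x s) (l s) k =
      rewardSum Γ l x k s / pulls Γ l x k s +
        Real.sqrt (α * (1 - normLoad lm lp (l s)) * Real.log ((s : ℝ) + 1) /
          pulls Γ l x k s) := by
  rw [ucbIndex, empMean, sum_history, pullsIn_history]

/-- Causality: rewards from slot `s` on have not been seen. This and its corollaries allow `past` to
replace the full reward array. -/
lemma history_congr {x' : Fin K → ℕ → ℝ} (s : ℕ) (h : ∀ j, ∀ r < s, x j r = x' j r) :
    history Γ l x s = history Γ l x' s := by
  induction s with
  | zero => rfl
  | succ s ih =>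
    have e := ih fun j r hr => h j r (hr.trans s.lt_succ_self)
    rw [history_succ, history_succ, action, action, e, h _ s s.lt_succ_self]

lemma action_congr {x' : Fin K → ℕ → ℝ} (s : ℕ) (h : ∀ j, ∀ r < s, x j r = x' j r) :
    action Γ l x s = action Γ l x' s := by
  rw [action, action, history_congr s h]

lemma pulls_congr {x' : Fin K → ℕ → ℝ} (k : Fin K) (s : ℕ) (h : ∀ j, ∀ r < s, x j r = x' j r) :
    pulls Γ l x k s = pulls Γ l x' k s := by
  rw [pulls_eq_sum, pulls_eq_sum]
  refine Finset.sum_congr rfl fun r hr => ?_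
  rw [action_congr r fun j q hq => h j q (hq.trans (Finset.mem_range.1 hr))]

lemma rewardSum_congr {x' : Fin K → ℕ → ℝ} (k : Fin K) (s : ℕ)
    (h : ∀ j, ∀ r < s, x j r = x' j r) :
    rewardSum Γ l x k s = rewardSum Γ l x' k s := by
  refine Finset.sum_congr rfl fun r hr => ?_
  rw [action_congr r fun j q hq => h j q (hq.trans (Finset.mem_range.1 hr)),
    h k r (Finset.mem_range.1 hr)]

lemma pulls_mono (k : Fin K) : Monotone (pulls Γ l x k) :=
  monotone_nat_of_le_succ fun s => by rw [pulls_succ]; exact Nat.le_add_right _ _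

lemma pulls_le (k : Fin K) (T : ℕ) : pulls Γ l x k T ≤ T :=
  (Finset.card_filter_le _ _).trans (Finset.card_range T).le

lemma pulls_lt_pulls {k : Fin K} {s t : ℕ} (hst : s < t) (hs : action Γ l x s = k) :
    pulls Γ l x k s < pulls Γ l x k t := by
  refine lt_of_lt_of_le ?_ (pulls_mono k (Nat.succ_le_of_lt hst))
  rw [Nat.succ_eq_add_one, pulls_succ, if_pos hs]
  exact Nat.lt_succ_self _

/-- An arm is pulled at most `c + 1` times while its number of earlier pulls is at most `c`. -/
lemma card_filter_pulls_le (k : Fin K) (T : ℕ) {c : ℝ} (hc : 0 ≤ c) :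
    (((Finset.range T).filter fun s => action Γ l x s = k ∧ (pulls Γ l x k s : ℝ) ≤ c).card : ℝ)
      ≤ c + 1 := by
  have h : ((Finset.range T).filter
      fun s => action Γ l x s = k ∧ (pulls Γ l x k s : ℝ) ≤ c).card ≤
        (Finset.range (⌊c⌋₊ + 1)).card := by
    -- The count of earlier pulls strictly increases from one pull of `k` to the next, so it injects
    -- these slots into {0, …, ⌊c⌋}.
    refine Finset.card_le_card_of_injOn (pulls Γ l x k) (fun s hs => ?_) (fun s hs t ht e => ?_)
    · simp only [Finset.coe_filter, Set.mem_ofPred_eq] at hs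
      simpa [Nat.lt_succ_iff] using Nat.le_floor hs.2.2
    · simp only [Finset.coe_filter, Set.mem_ofPred_eq] at hs ht
      rcases lt_trichotomy s t with hl | hl | hl
      · exact absurd e (pulls_lt_pulls hl hs.2.1).ne
      · exact hl
      · exact absurd e (pulls_lt_pulls hl ht.2.1).ne'
  rw [Finset.card_range] at h
  calc _ ≤ ((⌊c⌋₊ + 1 : ℕ) : ℝ) := by exact_mod_cast h
    _ ≤ c + 1 := by push_cast; linarith [Nat.floor_le hc]

lemma normLoad_nonneg {lm lp : ℝ} (h : lm ≤ lp) (y : ℝ) : 0 ≤ normLoad lm lp y := by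
  unfold normLoad
  split_ifs
  · exact le_rfl
  · exact zero_le_one
  · exact div_nonneg (sub_nonneg.2 (le_max_left _ _)) (sub_nonneg.2 h)

lemma normLoad_of_le {lm lp y : ℝ} (h : lm ≤ lp) (hy : y ≤ lm) : normLoad lm lp y = 0 := by
  unfold normLoad
  split_ifs
  · rfl
  · rw [min_eq_left (hy.trans h), max_eq_left hy]; simp

variable {α lm lp : ℝ}

/-- The first `K` slots never repeat an arm, so slot ↦ arm is an injective self-map of `Fin K`,
hence onto. This makes the denominators in the indices nonzero. -/
lemma IsAdaUCB.pulls_pos (hΓ : IsAdaUCB α lm lp Γ) (k : Fin K) {s : ℕ} (hs : K ≤ s) :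
    0 < pulls Γ l x k s := by
  have hinj : Function.Injective fun i : Fin K => action Γ l x i := by
    intro i j e
    have key : ∀ i j : Fin K, i < j → action Γ l x i ≠ action Γ l x j := fun i j hij e => by
      have h0 := hΓ.init j j.2 (history Γ l x j) (l j)
      rw [pullsIn_history] at h0
      have := pulls_lt_pulls (Γ := Γ) (l := l) (x := x) (s := i) (t := j) hij e
      exact absurd h0 (Nat.pos_of_ne_zero (by rintro h; simp only [action] at this; omega)).ne'
    rcases lt_trichotomy i j with h | h | h
    · exact absurd e (key i j h)
    · exact h
    · exact absurd e.symm (key j i h)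
  obtain ⟨i, hi⟩ := Finite.surjective_of_injective hinj k
  exact (Nat.zero_le _).trans_lt (pulls_lt_pulls (i.2.trans_le hs) hi)

/-- If the pulled arm has a small empirical mean and a small exploration bonus,
then all indices are small. -/
lemma IsAdaUCB.ucbIndex_lt (hΓ : IsAdaUCB α lm lp Γ) (hα : 0 ≤ α) (hl : lm ≤ lp) {s : ℕ}
    (hs : K ≤ s) {k : Fin K} (hk : action Γ l x s = k) {d e : ℝ} (hd : 0 ≤ d)
    (hbonus : α * Real.log ((s : ℝ) + 1) ≤ d ^ 2 * pulls Γ l x k s)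
    (hmean : rewardSum Γ l x k s < e * pulls Γ l x k s) (j : Fin K) :
    ucbIndex α lm lp (history Γ l x s) (l s) j < e + d := by
  refine (hΓ.argmax s hs (history Γ l x s) (l s) j).trans_lt ?_
  change ucbIndex α lm lp (history Γ l x s) (l s) (action Γ l x s) < e + d
  have hpos : (0 : ℝ) < pulls Γ l x k s := by exact_mod_cast hΓ.pulls_pos k hs
  rw [hk, ucbIndex_history]
  refine add_lt_add_of_lt_of_le ((div_lt_iff₀ hpos).2 hmean) (Real.sqrt_le_iff.2 ⟨hd, ?_⟩)
  rw [div_le_iff₀ hpos]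
  refine le_trans ?_ hbonus
  have h1 : 0 ≤ Real.log ((s : ℝ) + 1) := Real.log_nonneg (by simp)
  -- The load can only shrink the bonus, so the plain UCB bonus is an upper bound at every load.
  have h2 := normLoad_nonneg hl (l s)
  nlinarith [mul_nonneg (mul_nonneg hα h2) h1]

/-- The bonus is nonnegative and is dropped, which is all that can be done at an arbitrary load. -/
lemma rewardSum_le_of_ucbIndex_lt {j : Fin K} {s : ℕ} {c : ℝ} (hpos : 0 < pulls Γ l x j s)
    (h : ucbIndex α lm lp (history Γ l x s) (l s) j < c) :
    rewardSum Γ l x j s ≤ c * pulls Γ l x j s := by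
  rw [ucbIndex_history] at h
  have hpos : (0 : ℝ) < pulls Γ l x j s := by exact_mod_cast hpos
  rw [← div_le_iff₀ hpos]
  linarith [Real.sqrt_nonneg (α * (1 - normLoad lm lp (l s)) * Real.log ((s : ℝ) + 1) /
          pulls Γ l x j s)]

/-- At low load the normalized load is 0, so the full UCB bonus is available. The exploration
argument rests on this gain over `rewardSum_le_of_ucbIndex_lt`. -/
lemma rewardSum_le_of_ucbIndex_lt_of_le (hl : lm ≤ lp) {j : Fin K} {s : ℕ} {c : ℝ}
    (hls : l s ≤ lm) (hpos : 0 < pulls Γ l x j s)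
    (h : ucbIndex α lm lp (history Γ l x s) (l s) j < c) :
    rewardSum Γ l x j s ≤
      (c - Real.sqrt (α * Real.log ((s : ℝ) + 1) / pulls Γ l x j s)) * pulls Γ l x j s := by
  rw [ucbIndex_history, normLoad_of_le hl hls, sub_zero, mul_one] at h
  have hpos : (0 : ℝ) < pulls Γ l x j s := by exact_mod_cast hpos
  rw [← div_le_iff₀ hpos]
  linarith

end Deterministic

/-! ### Measurability in the loads and rewards -/

section Measurability

variable {K : ℕ} {Γ : Policy K}

lemma measurable_eval_arm {α : Type*} [MeasurableSpace α] {a : α → Fin K} {f : Fin K → α → ℝ}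
    (ha : Measurable a) (hf : ∀ k, Measurable (f k)) : Measurable fun p => f (a p) p := by
  have : (fun p => f (a p) p) = fun p => ∑ k, if a p = k then f k p else 0 := by
    funext p; simp
  rw [this]
  exact Finset.measurable_sum _ fun k _ =>
    Measurable.ite (ha (measurableSet_singleton k)) (hf k) measurable_const

lemma measurable_reward_coord (k : Fin K) (s : ℕ) :
    Measurable fun p : (ℕ → ℝ) × (Fin K → ℕ → ℝ) => p.2 k s := by fun_prop

lemma measurable_history (hΓ : ∀ s, Measurable fun p : (Fin s → Obs K) × ℝ => Γ s p.1 p.2)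
    (s : ℕ) :
    Measurable fun p : (ℕ → ℝ) × (Fin K → ℕ → ℝ) => history Γ p.1 p.2 s := by
  induction s with
  | zero => exact measurable_pi_iff.2 fun i => i.elim0
  | succ s ih =>
    have hl : Measurable fun p : (ℕ → ℝ) × (Fin K → ℕ → ℝ) => p.1 s := by fun_prop
    have ha : Measurable fun p : (ℕ → ℝ) × (Fin K → ℕ → ℝ) => action Γ p.1 p.2 s :=
      (hΓ s).comp (ih.prodMk hl)
    refine measurable_pi_iff.2 fun i => ?_
    simp only [history_succ]
    refine Fin.lastCases ?_ (fun i => ?_) i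
    · simp only [Fin.snoc_last]
      exact hl.prodMk (ha.prodMk (measurable_eval_arm ha fun k => measurable_reward_coord k s))
    · simp only [Fin.snoc_castSucc]
      exact (measurable_pi_apply i).comp ih

lemma measurable_action (hΓ : ∀ s, Measurable fun p : (Fin s → Obs K) × ℝ => Γ s p.1 p.2)
    (s : ℕ) :
    Measurable fun p : (ℕ → ℝ) × (Fin K → ℕ → ℝ) => action Γ p.1 p.2 s :=
  (hΓ s).comp ((measurable_history hΓ s).prodMk (by fun_prop))

lemma measurable_pulls (hΓ : ∀ s, Measurable fun p : (Fin s → Obs K) × ℝ => Γ s p.1 p.2)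
    (k : Fin K) (s : ℕ) :
    Measurable fun p : (ℕ → ℝ) × (Fin K → ℕ → ℝ) => pulls Γ p.1 p.2 k s := by
  simp only [pulls_eq_sum]
  exact Finset.measurable_sum _ fun r _ => Measurable.ite
    (measurable_action hΓ r (measurableSet_singleton k)) measurable_const measurable_const

lemma measurable_rewardSum (hΓ : ∀ s, Measurable fun p : (Fin s → Obs K) × ℝ => Γ s p.1 p.2)
    (k : Fin K) (s : ℕ) :
    Measurable fun p : (ℕ → ℝ) × (Fin K → ℕ → ℝ) => rewardSum Γ p.1 p.2 k s :=
  Finset.measurable_sum _ fun r _ => Measurable.ite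
    (measurable_action hΓ r (measurableSet_singleton k)) (measurable_reward_coord k r)
    measurable_const

end Measurability

/-! ### The past of a slot and its independence of the slot's rewards -/

section Past

variable {Ω : Type*} {K : ℕ} {L : ℕ → Ω → ℝ} {X : Fin K → ℕ → Ω → ℝ} {u : Fin K → ℝ} {Γ : Policy K}

/-- The loads together with the rewards of the slots before `s`. The rewards of the later slots
are replaced by `0`. -/
def past (L : ℕ → Ω → ℝ) (X : Fin K → ℕ → Ω → ℝ) (s : ℕ) (ω : Ω) :
    (ℕ → ℝ) × (Fin K → ℕ → ℝ) :=
  (fun r => L r ω, fun j r => if r < s then X j r ω else 0)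

lemma action_past (s : ℕ) (ω : Ω) :
    action Γ (past L X s ω).1 (past L X s ω).2 s
      = action Γ (fun r => L r ω) (fun j r => X j r ω) s :=
  action_congr s fun _ _ hr => if_pos hr

lemma pulls_past (k : Fin K) (s : ℕ) (ω : Ω) :
    pulls Γ (past L X s ω).1 (past L X s ω).2 k s
      = pulls Γ (fun r => L r ω) (fun j r => X j r ω) k s :=
  pulls_congr k s fun _ _ hr => if_pos hr

lemma rewardSum_past (k : Fin K) (s : ℕ) (ω : Ω) :
    rewardSum Γ (past L X s ω).1 (past L X s ω).2 k s
      = rewardSum Γ (fun r => L r ω) (fun j r => X j r ω) k s :=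
  rewardSum_congr k s fun _ _ hr => if_pos hr

variable [MeasurableSpace Ω] {μ : Measure Ω}

lemma IsOpportunisticBandit.measurable_past (h : IsOpportunisticBandit μ L X u) (s : ℕ) :
    Measurable (past L X s) := by
  refine (measurable_pi_iff.2 fun r => h.measurable_load r).prodMk
    (measurable_pi_iff.2 fun j => measurable_pi_iff.2 fun r => ?_)
  by_cases hr : r < s
  · simpa [hr] using h.measurable_reward j r
  · simp [hr]

lemma IsOpportunisticBandit.measurable_path (h : IsOpportunisticBandit μ L X u) :
    Measurable fun ω => ((fun r => L r ω, fun j r => X j r ω) : (ℕ → ℝ) × (Fin K → ℕ → ℝ)) :=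
  (measurable_pi_iff.2 h.measurable_load).prodMk
    (measurable_pi_iff.2 fun j => measurable_pi_iff.2 fun r => h.measurable_reward j r)

end Past

section Independence

variable {Ω : Type*} [MeasurableSpace Ω] {μ : Measure Ω} [IsProbabilityMeasure μ] {K : ℕ}
  {L : ℕ → Ω → ℝ} {X : Fin K → ℕ → Ω → ℝ} {u : Fin K → ℝ}

/-- If `Y` is independent of `(Z, W)` and `Z` is independent of `W`, then `(Y, Z)` is independent
of `W`. -/
lemma indepFun_prodMk_left {α β γ : Type*} [MeasurableSpace α] [MeasurableSpace β]
    [MeasurableSpace γ] {Y : Ω → α} {Z : Ω → β} {W : Ω → γ} (hY : Measurable Y)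
    (hZ : Measurable Z) (hW : Measurable W) (h : IndepFun Y (fun ω => (Z ω, W ω)) μ)
    (h' : IndepFun Z W μ) : IndepFun (fun ω => (Y ω, Z ω)) W μ := by
  have hYZ : IndepFun Y Z μ := h.comp measurable_id measurable_fst
  have := Measure.isProbabilityMeasure_map (μ := μ) hY.aemeasurable
  have := Measure.isProbabilityMeasure_map (μ := μ) hZ.aemeasurable
  have := Measure.isProbabilityMeasure_map (μ := μ) hW.aemeasurable
  -- Both laws are reassociated to Y × (Z × W), where the two hypotheses factor the joint law.
  rw [indepFun_iff_map_prod_eq_prod_map_map (hY.prodMk hZ).aemeasurable hW.aemeasurable,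
    (indepFun_iff_map_prod_eq_prod_map_map hY.aemeasurable hZ.aemeasurable).1 hYZ,
    ← MeasurableEquiv.prodAssoc.map_measurableEquiv_injective.eq_iff, Measure.prodAssoc_prod,
    Measure.map_map (by fun_prop) (by fun_prop),
    ← (indepFun_iff_map_prod_eq_prod_map_map hZ.aemeasurable hW.aemeasurable).1 h',
    ← (indepFun_iff_map_prod_eq_prod_map_map hY.aemeasurable (hZ.prodMk hW).aemeasurable).1 h]
  rfl

/-- All loads, even future ones, may be kept in the past because the load sequence is independent of
the whole reward array. The earlier rewards and `X k s` occupy disjoint sets of indices. -/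
lemma IsOpportunisticBandit.indepFun_past (h : IsOpportunisticBandit μ L X u) (k : Fin K)
    (s : ℕ) : IndepFun (past L X s) (X k s) μ := by
  have hL : Measurable fun ω (r : ℕ) => L r ω := measurable_pi_iff.2 h.measurable_load
  have hP := measurable_snd.comp (h.measurable_past s)
  refine indepFun_prodMk_left hL hP (h.measurable_reward k s) ?_ ?_
  · let g : (Fin K × ℕ → ℝ) → (Fin K → ℕ → ℝ) × ℝ :=
      fun x => (fun j r => if r < s then x (j, r) else 0, x (k, s))
    have hg : Measurable g := by
      refine Measurable.prodMk
        (measurable_pi_iff.2 fun j => measurable_pi_iff.2 fun r => ?_) (by fun_prop)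
      by_cases hr : r < s
      · simpa [hr] using measurable_pi_apply (j, r)
      · simp [hr]
    exact h.load_reward_indep.comp measurable_id hg
  · have key := h.reward_indep.indepFun_finset (Finset.univ ×ˢ Finset.range s) {(k, s)}
      (by simp) (fun p => h.measurable_reward p.1 p.2)
    let g : ((Finset.univ ×ˢ Finset.range s : Finset (Fin K × ℕ)) → ℝ) → Fin K → ℕ → ℝ :=
      fun x j r => if hr : r < s then x ⟨(j, r), by simpa using hr⟩ else 0
    have hg : Measurable g := by
      refine measurable_pi_iff.2 fun j => measurable_pi_iff.2 fun r => ?_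
      by_cases hr : r < s
      · simpa [g, hr] using measurable_pi_apply _
      · simp [g, hr]
    have hg' : Measurable fun x : (({(k, s)} : Finset (Fin K × ℕ)) → ℝ) =>
        x ⟨(k, s), by simp⟩ := by fun_prop
    exact key.comp hg hg'

end Independence

/-! ### Exponential supermartingale and tail bounds -/

section Concentration

variable {Ω : Type*} [MeasurableSpace Ω] {μ : Measure Ω} [IsProbabilityMeasure μ] {K : ℕ}
  {L : ℕ → Ω → ℝ} {X : Fin K → ℕ → Ω → ℝ} {u : Fin K → ℝ} {Γ : Policy K}

/-- Hoeffding's lemma on an interval of length 1: the variance proxy is 1/4, hence t²/8. -/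
lemma IsOpportunisticBandit.lintegral_exp_le (h : IsOpportunisticBandit μ L X u) (k : Fin K)
    (s : ℕ) (t : ℝ) :
    ∫⁻ ω, ENNReal.ofReal (Real.exp (t * (X k s ω - u k) - t ^ 2 / 8)) ∂μ ≤ 1 := by
  have hs := hasSubgaussianMGF_of_mem_Icc (h.measurable_reward k s).aemeasurable
    (h.reward_mem k s)
  rw [h.reward_mean] at hs
  have hint := hs.integrable_exp_mul t
  have hm := hs.mgf_le t
  simp only [mgf] at hm
  have e : ∀ ω, Real.exp (t * (X k s ω - u k) - t ^ 2 / 8)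
      = Real.exp (t * (X k s ω - u k)) * Real.exp (-(t ^ 2 / 8)) := fun ω => by
    rw [← Real.exp_add]; ring_nf
  simp only [e]
  rw [← ofReal_integral_eq_lintegral_ofReal (hint.mul_const _)
    (Eventually.of_forall fun ω => by positivity), integral_mul_const]
  rw [← ENNReal.ofReal_one]
  refine ENNReal.ofReal_le_ofReal ?_
  calc _ ≤ Real.exp (t ^ 2 / 8) * Real.exp (-(t ^ 2 / 8)) := by
        refine mul_le_mul_of_nonneg_right (hm.trans (le_of_eq ?_)) (Real.exp_pos _).le
        congr 1
        simp
        ring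
    _ = 1 := by rw [← Real.exp_add]; simp

/-- The exponential supermartingale of the centred rewards of one arm. -/
lemma IsOpportunisticBandit.lintegral_exp_rewardSum_le (h : IsOpportunisticBandit μ L X u)
    (hΓ : ∀ s, Measurable fun p : (Fin s → Obs K) × ℝ => Γ s p.1 p.2) (k : Fin K) (t : ℝ)
    (s : ℕ) :
    ∫⁻ ω, ENNReal.ofReal (Real.exp
      (t * (rewardSum Γ (fun r => L r ω) (fun j r => X j r ω) k s
          - u k * pulls Γ (fun r => L r ω) (fun j r => X j r ω) k s)
        - t ^ 2 / 8 * pulls Γ (fun r => L r ω) (fun j r => X j r ω) k s)) ∂μ ≤ 1 := by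
  induction s with
  | zero => simp [rewardSum, pulls]
  | succ s ih =>
    let M : (ℕ → ℝ) × (Fin K → ℕ → ℝ) → ENNReal := fun p => ENNReal.ofReal (Real.exp
      (t * (rewardSum Γ p.1 p.2 k s - u k * pulls Γ p.1 p.2 k s)
        - t ^ 2 / 8 * pulls Γ p.1 p.2 k s))
    have hM : Measurable M := by
      have h1 := measurable_rewardSum hΓ k s
      have h2 : Measurable fun p : (ℕ → ℝ) × (Fin K → ℕ → ℝ) => (pulls Γ p.1 p.2 k s : ℝ) :=
        measurable_from_top.comp (measurable_pulls hΓ k s)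
      fun_prop
    have hA : MeasurableSet {p : (ℕ → ℝ) × (Fin K → ℕ → ℝ) | action Γ p.1 p.2 s = k} :=
      measurable_action hΓ s (measurableSet_singleton k)
    let A := {p : (ℕ → ℝ) × (Fin K → ℕ → ℝ) | action Γ p.1 p.2 s = k}
    let g : ℝ → ENNReal := fun y => ENNReal.ofReal (Real.exp (t * (y - u k) - t ^ 2 / 8))
    have hg : Measurable g := by fun_prop
    have hM1 : Measurable (A.indicator M) := hM.indicator hA
    have hM2 : Measurable (Aᶜ.indicator M) := hM.indicator hA.compl
    have hpast := h.measurable_past s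
    have hMp : ∀ ω, M (past L X s ω) = ENNReal.ofReal (Real.exp
      (t * (rewardSum Γ (fun r => L r ω) (fun j r => X j r ω) k s
          - u k * pulls Γ (fun r => L r ω) (fun j r => X j r ω) k s)
        - t ^ 2 / 8 * pulls Γ (fun r => L r ω) (fun j r => X j r ω) k s)) := fun ω => by
      simp only [M, rewardSum_past, pulls_past]
    -- The arm of slot `s` is a function of the past. If it is `k`, the process gains an independent
    -- factor of mean at most 1; otherwise it does not change.
    have e : ∀ ω, ENNReal.ofReal (Real.exp
      (t * (rewardSum Γ (fun r => L r ω) (fun j r => X j r ω) k (s + 1)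
          - u k * pulls Γ (fun r => L r ω) (fun j r => X j r ω) k (s + 1))
        - t ^ 2 / 8 * pulls Γ (fun r => L r ω) (fun j r => X j r ω) k (s + 1)))
        = A.indicator M (past L X s ω) * g (X k s ω) + Aᶜ.indicator M (past L X s ω) := by
      intro ω
      rw [pulls_succ, rewardSum_succ]
      by_cases ha : action Γ (fun r => L r ω) (fun j r => X j r ω) s = k
      · have : past L X s ω ∈ A := by simpa [A, action_past] using ha
        rw [Set.indicator_of_mem this, Set.indicator_of_notMem (by simpa using this), hMp,
          if_pos ha, if_pos ha, ← ENNReal.ofReal_mul (Real.exp_pos _).le, ← Real.exp_add,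
          add_zero]
        congr 2
        push_cast
        ring
      · have : past L X s ω ∉ A := by simpa [A, action_past] using ha
        rw [Set.indicator_of_notMem this, Set.indicator_of_mem (by simpa using this), hMp,
          if_neg ha, if_neg ha]
        simp
    simp only [e]
    have hM2p : Measurable fun ω => Aᶜ.indicator M (past L X s ω) := hM2.comp hpast
    rw [lintegral_add_right _ hM2p]
    have hind : IndepFun (fun ω => A.indicator M (past L X s ω)) (fun ω => g (X k s ω)) μ :=
      (h.indepFun_past k s).comp hM1 hg
    have hmul := lintegral_mul_eq_lintegral_mul_lintegral_of_indepFun (hM1.comp hpast)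
      (hg.comp (h.measurable_reward k s)) hind
    calc _ = (∫⁻ ω, A.indicator M (past L X s ω) ∂μ) * (∫⁻ ω, g (X k s ω) ∂μ)
            + ∫⁻ ω, Aᶜ.indicator M (past L X s ω) ∂μ := congrArg (· + _) hmul
      _ ≤ (∫⁻ ω, A.indicator M (past L X s ω) ∂μ) * 1
            + ∫⁻ ω, Aᶜ.indicator M (past L X s ω) ∂μ := by
          gcongr
          exact h.lintegral_exp_le k s t
      _ = ∫⁻ ω, M (past L X s ω) ∂μ := by
          rw [mul_one, ← lintegral_add_right _ hM2p]
          refine lintegral_congr fun ω => ?_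
          exact congrFun (Set.indicator_self_add_compl A M) (past L X s ω)
      _ ≤ 1 := by simpa only [hMp] using ih

/-- Markov's inequality for the supermartingale. The random pull count stays in the exponent. -/
lemma IsOpportunisticBandit.measureReal_exp_tail_le (h : IsOpportunisticBandit μ L X u)
    (hΓ : ∀ s, Measurable fun p : (Fin s → Obs K) × ℝ => Γ s p.1 p.2) (k : Fin K) (t c : ℝ)
    (s : ℕ) :
    μ.real {ω | c ≤ t * (rewardSum Γ (fun r => L r ω) (fun j r => X j r ω) k s
          - u k * pulls Γ (fun r => L r ω) (fun j r => X j r ω) k s)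
        - t ^ 2 / 8 * pulls Γ (fun r => L r ω) (fun j r => X j r ω) k s} ≤ Real.exp (-c) := by
  have hm : Measurable fun ω => ENNReal.ofReal (Real.exp
      (t * (rewardSum Γ (fun r => L r ω) (fun j r => X j r ω) k s
          - u k * pulls Γ (fun r => L r ω) (fun j r => X j r ω) k s)
        - t ^ 2 / 8 * pulls Γ (fun r => L r ω) (fun j r => X j r ω) k s)) := by
    have h1 := (measurable_rewardSum hΓ k s).comp h.measurable_path
    have h2 : Measurable fun ω =>
        (pulls Γ (fun r => L r ω) (fun j r => X j r ω) k s : ℝ) :=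
      measurable_from_top.comp ((measurable_pulls hΓ k s).comp h.measurable_path)
    simp only [Function.comp_def] at h1
    fun_prop
  have key := (mul_meas_ge_le_lintegral (μ := μ) hm (ENNReal.ofReal (Real.exp c))).trans
    (h.lintegral_exp_rewardSum_le hΓ k t s)
  simp only [ENNReal.ofReal_le_ofReal_iff (Real.exp_pos _).le, Real.exp_le_exp] at key
  rw [mul_comm, ← ENNReal.le_div_iff_mul_le (Or.inl (by simp [Real.exp_pos])) (Or.inl (by simp)),
    one_div, ← ENNReal.ofReal_inv_of_pos (Real.exp_pos _), ← Real.exp_neg] at key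
  exact ENNReal.toReal_le_of_le_ofReal (Real.exp_pos _).le key

/-- The empirical mean of an arm with at least `n` pulls is unlikely to be too large. -/
lemma IsOpportunisticBandit.measureReal_upper_tail_le (h : IsOpportunisticBandit μ L X u)
    (hΓ : ∀ s, Measurable fun p : (Fin s → Obs K) × ℝ => Γ s p.1 p.2) (k : Fin K) {ε n : ℝ}
    (hε : 0 ≤ ε) (s : ℕ) :
    μ.real {ω | n ≤ pulls Γ (fun r => L r ω) (fun j r => X j r ω) k s ∧
        (u k + ε) * pulls Γ (fun r => L r ω) (fun j r => X j r ω) k s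
          ≤ rewardSum Γ (fun r => L r ω) (fun j r => X j r ω) k s}
      ≤ Real.exp (-(2 * ε ^ 2 * n)) := by
  -- t = 4ε maximizes tε - t²/8, with value 2ε². On the event the exponent is at least 2ε² times the
  -- pull count, hence at least 2ε²n.
  refine (measureReal_mono ?_).trans (h.measureReal_exp_tail_le hΓ k (4 * ε) (2 * ε ^ 2 * n) s)
  rintro ω ⟨h1, h2⟩
  have h3 := mul_le_mul_of_nonneg_left h1 (sq_nonneg ε)
  have h4 := mul_le_mul_of_nonneg_left h2 hε
  simp only [Set.mem_ofPred_eq]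
  linarith

/-- The empirical mean of an arm with at least `n` pulls is unlikely to be too small. -/
lemma IsOpportunisticBandit.measureReal_lower_tail_le (h : IsOpportunisticBandit μ L X u)
    (hΓ : ∀ s, Measurable fun p : (Fin s → Obs K) × ℝ => Γ s p.1 p.2) (k : Fin K) {ε n : ℝ}
    (hε : 0 ≤ ε) (s : ℕ) :
    μ.real {ω | n ≤ pulls Γ (fun r => L r ω) (fun j r => X j r ω) k s ∧
        rewardSum Γ (fun r => L r ω) (fun j r => X j r ω) k s ≤
          (u k - ε) * pulls Γ (fun r => L r ω) (fun j r => X j r ω) k s}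
      ≤ Real.exp (-(2 * ε ^ 2 * n)) := by
  refine (measureReal_mono ?_).trans (h.measureReal_exp_tail_le hΓ k (-4 * ε) (2 * ε ^ 2 * n) s)
  rintro ω ⟨h1, h2⟩
  have h3 := mul_le_mul_of_nonneg_left h1 (sq_nonneg ε)
  have h4 := mul_le_mul_of_nonneg_left h2 hε
  simp only [Set.mem_ofPred_eq]
  linarith

/-- The number of slots of low load in a window is unlikely to be less than half its mean. -/
lemma IsOpportunisticBandit.measureReal_lowLoad_le (h : IsOpportunisticBandit μ L X u)
    {lm ρ : ℝ} (hρ : 0 ≤ ρ) (hL : ∀ s, μ.real {ω | L s ω ≤ lm} = ρ) (W : Finset ℕ) :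
    μ.real {ω | ((W.filter fun s => L s ω ≤ lm).card : ℝ) ≤ ρ / 2 * W.card}
      ≤ Real.exp (-(ρ ^ 2 / 2 * W.card)) := by
  have hset : MeasurableSet (Set.Iic lm) := measurableSet_Iic
  -- The sign turns a deficit of low loads into an upper deviation of a sum of variables in [-1, 0].
  let f : ℝ → ℝ := fun y => -(Set.Iic lm).indicator 1 y
  have hf : Measurable f := (measurable_one.indicator hset).neg
  have hmean : ∀ s, ∫ ω, f (L s ω) ∂μ = -ρ := by
    intro s
    have : ∀ ω, f (L s ω) = -((L s ⁻¹' Set.Iic lm).indicator 1 ω) := fun ω => rfl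
    simp only [this]
    rw [integral_neg, integral_indicator_one (h.measurable_load s hset), ← hL s]
    rfl
  have hsub : ∀ s ∈ W, HasSubgaussianMGF (fun ω => f (L s ω) + ρ)
      ((‖(0 : ℝ) - (-1)‖₊ / 2) ^ 2) μ := by
    intro s _
    have := hasSubgaussianMGF_of_mem_Icc (μ := μ) (a := -1) (b := 0)
      (X := fun ω => f (L s ω)) (hf.comp (h.measurable_load s)).aemeasurable
      (Eventually.of_forall fun ω => by
        by_cases hω : L s ω ∈ Set.Iic lm <;> simp [f, hω])
    rw [hmean] at this
    simpa only [sub_neg_eq_add] using this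
  have hind : iIndepFun (fun s ω => f (L s ω) + ρ) μ :=
    h.load_indep.comp (fun _ y => f y + ρ) fun _ => hf.add_const ρ
  have key := HasSubgaussianMGF.measure_sum_ge_le_of_iIndepFun hind hsub
    (ε := ρ / 2 * W.card) (by positivity)
  rcases W.eq_empty_or_nonempty with rfl | hW
  · simp
  have hc : (0 : ℝ) < W.card := by exact_mod_cast hW.card_pos
  refine (measureReal_mono ?_).trans (key.trans (le_of_eq ?_))
  · intro ω hω
    simp only [Set.mem_ofPred_eq] at hω ⊢
    have : ∑ s ∈ W, (f (L s ω) + ρ) = W.card * ρ - (W.filter fun s => L s ω ≤ lm).card := by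
      rw [Finset.sum_add_distrib, Finset.sum_neg_distrib, Finset.card_filter]
      simp [Set.indicator_apply, mul_comm]
      ring
    rw [this]
    linarith
  · congr 1
    simp
    field_simp

end Concentration

/-! ### Exploration of the best arm through low-load slots -/

/-- If the indices do not err, there are few slots of low load in a window `W` unless the best arm
has been pulled often. -/
lemma IsAdaUCB.card_lowLoad_le {K : ℕ} {Γ : Policy K} {l : ℕ → ℝ} {x : Fin K → ℕ → ℝ}
    {α lm lp : ℝ} (hΓ : IsAdaUCB α lm lp Γ) (hα : 0 ≤ α) (hl : lm ≤ lp) {u : Fin K → ℝ}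
    {kstar : Fin K} (hbest : ∀ k, k ≠ kstar → u k < u kstar) {s : ℕ} {W : Finset ℕ}
    (hW : W ⊆ Finset.range s) (hK : ∀ r ∈ W, K ≤ r)
    (hstar : ∀ r ∈ W, ¬ rewardSum Γ l x kstar r ≤
      (u kstar - Real.sqrt (α * Real.log ((r : ℝ) + 1) / pulls Γ l x kstar r))
        * pulls Γ l x kstar r)
    (hsub : ∀ r ∈ W, ∀ j, j ≠ kstar →
      ¬ (4 * α * Real.log ((s : ℝ) + 1) / (u kstar - u j) ^ 2 ≤ pulls Γ l x j r ∧
        (u j + (u kstar - u j) / 2) * pulls Γ l x j r ≤ rewardSum Γ l x j r)) :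
    ((W.filter fun r => l r ≤ lm).card : ℝ) ≤ pulls Γ l x kstar s +
      ∑ j, (4 * α * Real.log ((s : ℝ) + 1) / (u kstar - u j) ^ 2 + 1) := by
  classical
  set c : Fin K → ℝ := fun j => 4 * α * Real.log ((s : ℝ) + 1) / (u kstar - u j) ^ 2 with hc
  have hlog : 0 ≤ Real.log ((s : ℝ) + 1) := Real.log_nonneg (by simp)
  -- For `j = kstar` the division by zero gives `c j = 0`, so the sum may run over all arms.
  have hc0 : ∀ j, 0 ≤ c j := fun j => by positivity
  have hcover : (W.filter fun r => l r ≤ lm) ⊆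
      ((Finset.range s).filter fun r => action Γ l x r = kstar) ∪
        Finset.univ.biUnion fun j => (Finset.range s).filter
          fun r => action Γ l x r = j ∧ (pulls Γ l x j r : ℝ) ≤ c j := by
    intro r hr
    obtain ⟨hrW, hlow⟩ := Finset.mem_filter.1 hr
    have hrs := hW hrW
    by_cases hj : action Γ l x r = kstar
    · exact Finset.mem_union_left _ (Finset.mem_filter.2 ⟨hrs, hj⟩)
    refine Finset.mem_union_right _ (Finset.mem_biUnion.2
      ⟨action Γ l x r, Finset.mem_univ _, Finset.mem_filter.2 ⟨hrs, rfl, ?_⟩⟩)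
    by_contra hgt
    push Not at hgt
    set j := action Γ l x r with hjdef
    have hΔ : 0 < u kstar - u j := sub_pos.2 (hbest j hj)
    have hmean : rewardSum Γ l x j r < (u j + (u kstar - u j) / 2) * pulls Γ l x j r :=
      not_le.1 fun hle => hsub r hrW j hj ⟨hgt.le, hle⟩
    have hbonus : α * Real.log ((r : ℝ) + 1) ≤ ((u kstar - u j) / 2) ^ 2 * pulls Γ l x j r := by
      have h1 : α * Real.log ((r : ℝ) + 1) ≤ α * Real.log ((s : ℝ) + 1) := by
        have : (r : ℝ) ≤ s := by exact_mod_cast (Finset.mem_range.1 hrs).le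
        gcongr
      have h2 := hgt.le
      rw [hc, div_le_iff₀ (by positivity)] at h2
      linarith
    -- Half the gap goes to the mean of arm `j` and half to its bonus. The best index then falls
    -- below `u kstar`, which `hstar` excludes at low load.
    have hidx := hΓ.ucbIndex_lt hα hl (hK r hrW) hjdef.symm (by positivity) hbonus hmean kstar
    rw [show u j + (u kstar - u j) / 2 + (u kstar - u j) / 2 = u kstar by ring] at hidx
    exact hstar r hrW
      (rewardSum_le_of_ucbIndex_lt_of_le hl hlow (hΓ.pulls_pos kstar (hK r hrW)) hidx)
  calc ((W.filter fun r => l r ≤ lm).card : ℝ)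
      ≤ (((Finset.range s).filter fun r => action Γ l x r = kstar).card +
        ∑ j, ((Finset.range s).filter
          fun r => action Γ l x r = j ∧ (pulls Γ l x j r : ℝ) ≤ c j).card : ℕ) := by
        exact_mod_cast (Finset.card_le_card hcover).trans ((Finset.card_union_le _ _).trans
          (Nat.add_le_add_left Finset.card_biUnion_le _))
    _ ≤ _ := by
        push_cast
        exact add_le_add le_rfl
          (Finset.sum_le_sum fun j _ => card_filter_pulls_le j s (hc0 j))

/-- The fourth power pays for a union over at most s² pairs (slot, pull count) and still leaves a
summable (s+1)⁻². -/
lemma exp_neg_two_mul_log_le {α y : ℝ} (hα : 2 < α) (hy : 1 ≤ y) :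
    Real.exp (-(2 * (α * Real.log y))) ≤ (y ^ 4)⁻¹ := by
  have hy0 : 0 < y := by linarith
  rw [← Real.exp_log (show 0 < (y ^ 4)⁻¹ by positivity), Real.log_inv, Real.log_pow]
  refine Real.exp_le_exp.2 (neg_le_neg ?_)
  have := Real.log_nonneg hy
  push_cast
  nlinarith

section Exploration

variable {Ω : Type*} [MeasurableSpace Ω] {μ : Measure Ω} [IsProbabilityMeasure μ] {K : ℕ}
  {L : ℕ → Ω → ℝ} {X : Fin K → ℕ → Ω → ℝ} {u : Fin K → ℝ} {Γ : Policy K}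

/-- The bonus holds a fixed `n` instead of the random pull count, so that the deviation in the tail
bound is deterministic. A union over `n` later recovers the true bonus, at `n` equal to the count.
-/
lemma IsOpportunisticBandit.measureReal_bestIndex_le (h : IsOpportunisticBandit μ L X u)
    (hΓ : ∀ s, Measurable fun p : (Fin s → Obs K) × ℝ => Γ s p.1 p.2) (k : Fin K) {α : ℝ}
    (hα : 2 < α) {n : ℕ} (hn : 0 < n) (r : ℕ) :
    μ.real {ω | (n : ℝ) ≤ pulls Γ (fun r => L r ω) (fun j r => X j r ω) k r ∧
        rewardSum Γ (fun r => L r ω) (fun j r => X j r ω) k r ≤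
          (u k - Real.sqrt (α * Real.log ((r : ℝ) + 1) / n)) *
            pulls Γ (fun r => L r ω) (fun j r => X j r ω) k r} ≤ (((r : ℝ) + 1) ^ 4)⁻¹ := by
  refine (h.measureReal_lower_tail_le hΓ k (Real.sqrt_nonneg _) r).trans ?_
  have hlog : 0 ≤ Real.log ((r : ℝ) + 1) := Real.log_nonneg (by simp)
  have hn' : (0 : ℝ) < n := by exact_mod_cast hn
  rw [Real.sq_sqrt (by positivity), mul_assoc, div_mul_cancel₀ _ hn'.ne']
  exact exp_neg_two_mul_log_le hα (by simp)

/-- Outside the bad events, the window [s/2, s) has more than ρs/4 low-load slots, and by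
`card_lowLoad_le` and `hc` fewer than that would be possible with only `c` pulls of the best arm.
Starting at s/2 keeps the errors of all slots in the window of order (s+1)⁻⁴. -/
lemma IsOpportunisticBandit.measureReal_pulls_le (h : IsOpportunisticBandit μ L X u)
    {α ρ lm lp c : ℝ} (hα : 2 < α) (hρ : 0 ≤ ρ) (hL : ∀ s, μ.real {ω | L s ω ≤ lm} = ρ)
    (hl : lm ≤ lp) (hΓ : IsAdaUCB α lm lp Γ) {kstar : Fin K}
    (hbest : ∀ k, k ≠ kstar → u k < u kstar) {s : ℕ} (hs : K ≤ s / 2)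
    (hc : c + ∑ j, (4 * α * Real.log ((s : ℝ) + 1) / (u kstar - u j) ^ 2 + 1) ≤ ρ / 4 * s) :
    μ.real {ω | (pulls Γ (fun r => L r ω) (fun j r => X j r ω) kstar s : ℝ) ≤ c}
      ≤ Real.exp (-(ρ ^ 2 / 4 * s)) + (16 + K) / ((s : ℝ) + 1) ^ 2 := by
  classical
  have hα0 : 0 ≤ α := by linarith
  set W := Finset.Ico (s / 2) s with hWdef
  have hcard : (s : ℝ) / 2 ≤ W.card := by
    rw [hWdef, Nat.card_Ico]
    have : s ≤ 2 * (s - s / 2) := by omega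
    have : (s : ℝ) ≤ 2 * ((s - s / 2 : ℕ) : ℝ) := by exact_mod_cast this
    linarith
  have hcard' : (W.card : ℝ) ≤ s := by
    rw [hWdef, Nat.card_Ico]
    exact_mod_cast Nat.sub_le _ _
  let low : Set Ω := {ω | ((W.filter fun s => L s ω ≤ lm).card : ℝ) ≤ ρ / 2 * W.card}
  let P : ℕ → ℕ → Set Ω := fun r n =>
    {ω | (n : ℝ) ≤ pulls Γ (fun r => L r ω) (fun j r => X j r ω) kstar r ∧
        rewardSum Γ (fun r => L r ω) (fun j r => X j r ω) kstar r ≤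
          (u kstar - Real.sqrt (α * Real.log ((r : ℝ) + 1) / n)) *
            pulls Γ (fun r => L r ω) (fun j r => X j r ω) kstar r}
  let Q : ℕ → Fin K → Set Ω := fun r j =>
    {ω | 4 * α * Real.log ((s : ℝ) + 1) / (u kstar - u j) ^ 2 ≤
          pulls Γ (fun r => L r ω) (fun j r => X j r ω) j r ∧
        (u j + (u kstar - u j) / 2) * pulls Γ (fun r => L r ω) (fun j r => X j r ω) j r ≤
          rewardSum Γ (fun r => L r ω) (fun j r => X j r ω) j r}
  have hcover : {ω | (pulls Γ (fun r => L r ω) (fun j r => X j r ω) kstar s : ℝ) ≤ c} ⊆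
      low ∪ ((⋃ r ∈ W, ⋃ n ∈ Finset.Icc 1 s, P r n) ∪
        ⋃ r ∈ W, ⋃ j ∈ Finset.univ.erase kstar, Q r j) := by
    intro ω hω
    by_contra hcon
    simp only [Set.mem_union, Set.mem_iUnion, not_or, not_exists] at hcon
    obtain ⟨hlow, hP, hQ⟩ := hcon
    have hKW : ∀ r ∈ W, K ≤ r := fun r hr => hs.trans (Finset.mem_Ico.1 hr).1
    have key := hΓ.card_lowLoad_le (l := fun r => L r ω) (x := fun j r => X j r ω) hα0 hl hbest
      (s := s) (W := W) (fun r hr => Finset.mem_range.2 (Finset.mem_Ico.1 hr).2) hKW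
      (fun r hr hle => hP r hr (pulls Γ (fun r => L r ω) (fun j r => X j r ω) kstar r)
        (Finset.mem_Icc.2 ⟨hΓ.pulls_pos kstar (hKW r hr),
          (pulls_le kstar r).trans (Finset.mem_Ico.1 hr).2.le⟩) ⟨le_rfl, hle⟩)
      (fun r hr j hj hq => hQ r hr j (Finset.mem_erase.2 ⟨hj, Finset.mem_univ _⟩) hq)
    simp only [low, Set.mem_ofPred_eq, not_le] at hlow hω
    have : ρ / 4 * s ≤ ρ / 2 * W.card := by nlinarith
    linarith
  have hlowP : μ.real low ≤ Real.exp (-(ρ ^ 2 / 4 * s)) := by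
    refine (h.measureReal_lowLoad_le hρ hL W).trans (Real.exp_le_exp.2 ?_)
    nlinarith [mul_le_mul_of_nonneg_left hcard (sq_nonneg ρ)]
  have hs1 : (0 : ℝ) < (s : ℝ) + 1 := by positivity
  have hPP : μ.real (⋃ r ∈ W, ⋃ n ∈ Finset.Icc 1 s, P r n) ≤ 16 / ((s : ℝ) + 1) ^ 2 := by
    have hb : ∀ r ∈ W, μ.real (⋃ n ∈ Finset.Icc 1 s, P r n) ≤ s * (16 / ((s : ℝ) + 1) ^ 4) := by
      intro r hr
      refine (measureReal_biUnion_finset_le _ _).trans ?_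
      refine (Finset.sum_le_card_nsmul _ _ (16 / ((s : ℝ) + 1) ^ 4) fun n hn => ?_).trans
        (by simp)
      refine (h.measureReal_bestIndex_le hΓ.measurable kstar hα (Finset.mem_Icc.1 hn).1 r).trans ?_
      -- The window starts at s/2, and the fourth power of this factor 2 is the constant 16.
      have h1 : s + 1 ≤ 2 * (r + 1) := by have := (Finset.mem_Ico.1 hr).1; omega
      have h2 : (s : ℝ) + 1 ≤ 2 * ((r : ℝ) + 1) := by exact_mod_cast h1
      have h3 := pow_le_pow_left₀ hs1.le h2 4
      rw [inv_eq_one_div, div_le_div_iff₀ (by positivity) (by positivity)]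
      linarith
    refine (measureReal_biUnion_finset_le _ _).trans
      ((Finset.sum_le_card_nsmul _ _ _ hb).trans ?_)
    rw [nsmul_eq_mul]
    calc (W.card : ℝ) * (s * (16 / ((s : ℝ) + 1) ^ 4))
        ≤ ((s : ℝ) + 1) * (((s : ℝ) + 1) * (16 / ((s : ℝ) + 1) ^ 4)) := by
          gcongr <;> linarith
      _ = _ := by field_simp
  have hQQ : μ.real (⋃ r ∈ W, ⋃ j ∈ Finset.univ.erase kstar, Q r j)
      ≤ K / ((s : ℝ) + 1) ^ 2 := by
    have hb : ∀ r ∈ W, μ.real (⋃ j ∈ Finset.univ.erase kstar, Q r j)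
        ≤ K * (1 / ((s : ℝ) + 1) ^ 4) := by
      intro r hr
      refine (measureReal_biUnion_finset_le _ _).trans ?_
      refine (Finset.sum_le_card_nsmul _ _ (1 / ((s : ℝ) + 1) ^ 4) fun j hj => ?_).trans ?_
      · have hΔ : 0 < u kstar - u j := sub_pos.2 (hbest j (Finset.mem_erase.1 hj).1)
        refine (h.measureReal_upper_tail_le hΓ.measurable j (by positivity) r).trans ?_
        rw [one_div]
        refine le_trans (le_of_eq ?_) (exp_neg_two_mul_log_le hα (by simp))
        congr 2
        field_simp
        ring
      · rw [nsmul_eq_mul]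
        gcongr
        simp
    refine (measureReal_biUnion_finset_le _ _).trans
      ((Finset.sum_le_card_nsmul _ _ _ hb).trans ?_)
    rw [nsmul_eq_mul]
    have h1 : (1 : ℝ) ≤ (s : ℝ) + 1 := by simp
    calc (W.card : ℝ) * (K * (1 / ((s : ℝ) + 1) ^ 4))
        ≤ (((s : ℝ) + 1) ^ 2) * (K * (1 / ((s : ℝ) + 1) ^ 4)) := by
          gcongr
          nlinarith
      _ = _ := by field_simp
  calc _ ≤ _ := measureReal_mono hcover
    _ ≤ μ.real low + (μ.real (⋃ r ∈ W, ⋃ n ∈ Finset.Icc 1 s, P r n) +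
        μ.real (⋃ r ∈ W, ⋃ j ∈ Finset.univ.erase kstar, Q r j)) :=
      (measureReal_union_le _ _).trans (add_le_add le_rfl (measureReal_union_le _ _))
    _ ≤ _ := by rw [add_div]; linarith

end Exploration

lemma eventually_mul_log_add_le {A b δ : ℝ} (hA : 0 ≤ A) (hδ : 0 < δ) :
    ∀ᶠ s : ℕ in atTop, A * Real.log ((s : ℝ) + 1) + b ≤ δ * s := by
  have ht : Tendsto (fun s : ℕ => (s : ℝ) + 1) atTop atTop :=
    tendsto_atTop_add_const_right _ _ tendsto_natCast_atTop_atTop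
  have h1 := (Real.isLittleO_log_id_atTop.comp_tendsto ht).def
    (show 0 < δ / (2 * (A + 1)) by positivity)
  have h2 : ∀ᶠ s : ℕ in atTop, (b + δ / 2) / (δ / 2) ≤ (s : ℝ) :=
    tendsto_natCast_atTop_atTop.eventually_ge_atTop _
  filter_upwards [h1, h2] with s h1 h2
  simp only [Function.comp_apply, id] at h1
  rw [Real.norm_of_nonneg (Real.log_nonneg (by simp)), Real.norm_of_nonneg (by positivity),
    div_mul_eq_mul_div, le_div_iff₀ (by positivity)] at h1
  rw [div_le_iff₀ (by positivity)] at h2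
  have h3 : 0 ≤ Real.log ((s : ℝ) + 1) := Real.log_nonneg (by simp)
  nlinarith

lemma summable_inv_succ_sq (a : ℝ) : Summable fun s : ℕ => a / ((s : ℝ) + 1) ^ 2 := by
  have := (summable_nat_add_iff 1).2 (Real.summable_one_div_nat_pow.2 one_lt_two)
  simpa [div_eq_mul_inv] using this.mul_left a

/-- AdaUCB pulls the best arm at least `c log t` times in the first `t` slots, up to events of
summable probability. -/
lemma exists_summable_measureReal_pulls_le {K : ℕ} {α ρ : ℝ} (hα : 2 < α) (hρ : 0 < ρ)
    {u : Fin K → ℝ} {kstar : Fin K} (hbest : ∀ k, k ≠ kstar → u k < u kstar) {c : ℝ}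
    (hc : 0 ≤ c) :
    ∃ f : ℕ → ℝ, Summable f ∧ (∀ s, 0 ≤ f s) ∧
      ∀ {Ω : Type*} [MeasurableSpace Ω] (μ : Measure Ω) [IsProbabilityMeasure μ]
        (L : ℕ → Ω → ℝ) (X : Fin K → ℕ → Ω → ℝ) (lm lp : ℝ) (Γ : Policy K),
        IsOpportunisticBandit μ L X u → (∀ s, μ.real {ω | L s ω ≤ lm} = ρ) → lm ≤ lp →
        IsAdaUCB α lm lp Γ → ∀ s,
        μ.real {ω | (pulls Γ (fun r => L r ω) (fun j r => X j r ω) kstar s : ℝ)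
          ≤ c * Real.log ((s : ℝ) + 1)} ≤ f s := by
  -- Beyond `N` the logarithmic terms fit into ρs/4, with `b = K` collecting the `+ 1` of each arm,
  -- and s ≥ 2K. Before `N` the trivial bound 1 is used. `N` is fixed before the probability space,
  -- so `f` is uniform over bandits and policies.
  obtain ⟨N, hN⟩ := eventually_atTop.1 ((eventually_mul_log_add_le (b := K)
    (A := c + ∑ j, 4 * α / (u kstar - u j) ^ 2) (by positivity)
    (show 0 < ρ / 4 by positivity)).and (eventually_ge_atTop (2 * K)))
  refine ⟨fun s => (if s ∈ Finset.range N then 1 else 0) +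
    (Real.exp (s * -(ρ ^ 2 / 4)) + (16 + K) / ((s : ℝ) + 1) ^ 2), ?_, fun s => ?_, ?_⟩
  · refine Summable.add (summable_of_ne_finset_zero (s := Finset.range N) ?_)
      (Summable.add ?_ (summable_inv_succ_sq _))
    · exact fun s hs => if_neg hs
    · exact Real.summable_exp_nat_mul_iff.2 (by simp; positivity)
  · have : (0 : ℝ) ≤ if s ∈ Finset.range N then 1 else 0 := by split_ifs <;> norm_num
    positivity
  · intro Ω _ μ _ L X lm lp Γ h hL hl hΓ s
    beta_reduce
    by_cases hs : s < N
    · rw [if_pos (Finset.mem_range.2 hs)]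
      have : 0 ≤ Real.exp (s * -(ρ ^ 2 / 4)) + (16 + K) / ((s : ℝ) + 1) ^ 2 := by positivity
      linarith [measureReal_le_one (μ := μ)
        (s := {ω | (pulls Γ (fun r => L r ω) (fun j r => X j r ω) kstar s : ℝ)
          ≤ c * Real.log ((s : ℝ) + 1)})]
    · rw [if_neg (by simpa using hs), zero_add]
      obtain ⟨h1, h2⟩ := hN s (not_lt.1 hs)
      refine (h.measureReal_pulls_le hα hρ.le hL hl hΓ hbest (by omega) ?_).trans
        (le_of_eq (by ring_nf))
      refine le_trans (le_of_eq ?_) h1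
      rw [Finset.sum_add_distrib, add_mul, Finset.sum_mul]
      simp [add_assoc, div_mul_eq_mul_div]

/-! ### Regret in terms of expected pulls -/

section Regret

variable {Ω : Type*} [MeasurableSpace Ω] {μ : Measure Ω} {K : ℕ} {L : ℕ → Ω → ℝ}
  {X : Fin K → ℕ → Ω → ℝ} {u : Fin K → ℝ} {Γ : Policy K}

lemma IsOpportunisticBandit.measurableSet_action (h : IsOpportunisticBandit μ L X u)
    (hΓ : ∀ s, Measurable fun p : (Fin s → Obs K) × ℝ => Γ s p.1 p.2) (k : Fin K) (s : ℕ) :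
    MeasurableSet {ω | action Γ (fun r => L r ω) (fun j r => X j r ω) s = k} :=
  ((measurable_action hΓ s).comp h.measurable_path) (measurableSet_singleton k)

variable [IsProbabilityMeasure μ]

lemma IsOpportunisticBandit.expPulls_eq_sum (h : IsOpportunisticBandit μ L X u)
    (hΓ : ∀ s, Measurable fun p : (Fin s → Obs K) × ℝ => Γ s p.1 p.2) (k : Fin K) (T : ℕ) :
    expPulls μ Γ L X k T = ∑ s ∈ Finset.range T,
      μ.real {ω | action Γ (fun r => L r ω) (fun j r => X j r ω) s = k} := by
  have e : ∀ ω, (pulls Γ (fun s => L s ω) (fun j s => X j s ω) k T : ℝ) =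
      ∑ s ∈ Finset.range T,
        {ω | action Γ (fun r => L r ω) (fun j r => X j r ω) s = k}.indicator 1 ω := by
    intro ω
    rw [pulls_eq_sum]
    push_cast
    exact Finset.sum_congr rfl fun s _ => by simp [Set.indicator_apply]
  simp only [expPulls, e]
  have hint : ∀ s ∈ Finset.range T, Integrable
      ({ω | action Γ (fun r => L r ω) (fun j r => X j r ω) s = k}.indicator (1 : Ω → ℝ)) μ :=
    fun s _ => (integrable_const (1 : ℝ)).indicator (h.measurableSet_action hΓ k s)
  rw [integral_finsetSum _ hint]
  exact Finset.sum_congr rfl fun s _ => integral_indicator_one (h.measurableSet_action hΓ k s)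

/-- Only the pulls of suboptimal arms contribute to the regret. -/
lemma IsOpportunisticBandit.regret_mem_Icc (h : IsOpportunisticBandit μ L X u)
    (hΓ : ∀ s, Measurable fun p : (Fin s → Obs K) × ℝ => Γ s p.1 p.2) {kstar : Fin K}
    (hbest : ∀ k, u k ≤ u kstar) (T : ℕ) :
    regret μ Γ L X u T ∈
      Set.Icc 0 (∑ k, (u kstar - u k) * expPulls μ Γ L X k T) := by
  have hsup : ⨆ k, u k = u kstar := by
    have : Nonempty (Fin K) := ⟨kstar⟩
    exact le_antisymm (ciSup_le hbest) (le_ciSup (Set.finite_range u).bddAbove kstar)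
  let A : Fin K → ℕ → Set Ω := fun k s =>
    {ω | action Γ (fun r => L r ω) (fun j r => X j r ω) s = k}
  have hA : ∀ k s, MeasurableSet (A k s) := h.measurableSet_action hΓ
  have hLint : ∀ s, Integrable (L s) μ := fun s =>
    Integrable.of_mem_Icc 0 1 (h.measurable_load s).aemeasurable (h.load_mem s)
  have hXint : ∀ k s, Integrable (X k s) μ := fun k s =>
    Integrable.of_mem_Icc 0 1 (h.measurable_reward k s).aemeasurable (h.reward_mem k s)
  have hLA : ∀ k s, Integrable ((A k s).indicator (L s)) μ := fun k s =>
    (hLint s).indicator (hA k s)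
  -- The arm of slot `s` and its load are both functions of the past, so the expected reward factors
  -- through `u k` even though the arm depends on the load.
  have hind : ∀ k s, IndepFun ((A k s).indicator (L s)) (X k s) μ := by
    intro k s
    let B := {p : (ℕ → ℝ) × (Fin K → ℕ → ℝ) | action Γ p.1 p.2 s = k}
    have hB : MeasurableSet B := measurable_action hΓ s (measurableSet_singleton k)
    let g : (ℕ → ℝ) × (Fin K → ℕ → ℝ) → ℝ := B.indicator fun p => p.1 s
    have hg : Measurable g := Measurable.indicator (by fun_prop) hB
    have e : (A k s).indicator (L s) = g ∘ past L X s := by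
      funext ω
      simp only [g, B, A, Set.indicator_apply, Function.comp_apply, Set.mem_ofPred_eq, action_past]
      rfl
    rw [e]
    exact (h.indepFun_past k s).comp hg measurable_id
  have hload : ∀ s, ∫ ω, L s ω ∂μ = ∑ k, ∫ ω, (A k s).indicator (L s) ω ∂μ := by
    intro s
    rw [← integral_finsetSum _ fun k _ => hLA k s]
    refine integral_congr_ae (Eventually.of_forall fun ω => ?_)
    simp [A, Set.indicator_apply]
  have hrew : ∀ s, ∫ ω, L s ω * X (action Γ (fun r => L r ω) (fun j r => X j r ω) s) s ω ∂μ
      = ∑ k, (∫ ω, (A k s).indicator (L s) ω ∂μ) * u k := by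
    intro s
    have e : ∀ ω, L s ω * X (action Γ (fun r => L r ω) (fun j r => X j r ω) s) s ω
        = ∑ k, (A k s).indicator (L s) ω * X k s ω := fun ω => by
      simp [A, Set.indicator_apply, ite_mul]
    have hint : ∀ k ∈ Finset.univ, Integrable (fun ω => (A k s).indicator (L s) ω * X k s ω) μ :=
      fun k _ => (hind k s).integrable_mul (hLA k s) (hXint k s)
    simp only [e]
    rw [integral_finsetSum _ hint]
    refine Finset.sum_congr rfl fun k _ => ?_
    rw [← h.reward_mean k s]
    exact (hind k s).integral_mul_eq_mul_integral (hLA k s).aestronglyMeasurable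
      (hXint k s).aestronglyMeasurable
  have hreg : regret μ Γ L X u T = ∑ k, (u kstar - u k) *
      ∑ s ∈ Finset.range T, ∫ ω, (A k s).indicator (L s) ω ∂μ := by
    rw [regret, hsup, integral_finsetSum _ fun s _ => hLint s]
    simp only [hload, hrew, Finset.mul_sum]
    rw [← Finset.sum_sub_distrib, Finset.sum_comm]
    refine Finset.sum_congr rfl fun s _ => ?_
    rw [← Finset.sum_sub_distrib]
    exact Finset.sum_congr rfl fun k _ => by ring
  have hnn : ∀ k s, 0 ≤ ∫ ω, (A k s).indicator (L s) ω ∂μ := fun k s =>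
    integral_nonneg_of_ae (by
      filter_upwards [h.load_mem s] with ω hω
      exact Set.indicator_apply_nonneg fun _ => hω.1)
  have hle : ∀ k s, ∫ ω, (A k s).indicator (L s) ω ∂μ ≤ μ.real (A k s) := fun k s => by
    rw [← integral_indicator_one (hA k s)]
    refine integral_mono_ae (hLA k s) ((integrable_const (1 : ℝ)).indicator (hA k s)) ?_
    filter_upwards [h.load_mem s] with ω hω
    simp only [Set.indicator_apply]
    split_ifs
    exacts [hω.2, le_rfl]
  rw [hreg]
  refine ⟨Finset.sum_nonneg fun k _ => mul_nonneg (sub_nonneg.2 (hbest k))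
    (Finset.sum_nonneg fun s _ => hnn k s), Finset.sum_le_sum fun k _ => ?_⟩
  rw [h.expPulls_eq_sum hΓ]
  exact mul_le_mul_of_nonneg_left (Finset.sum_le_sum fun s _ => hle k s) (sub_nonneg.2 (hbest k))

end Regret

/-! ### Expected pulls of a suboptimal arm -/

/-- A pull of a suboptimal arm that has already been pulled often requires a deviation of the
empirical mean of this arm or of the best arm. -/
lemma IsAdaUCB.rewardSum_le_of_action {K : ℕ} {Γ : Policy K} {l : ℕ → ℝ} {x : Fin K → ℕ → ℝ}
    {α lm lp : ℝ} (hΓ : IsAdaUCB α lm lp Γ) (hα : 0 ≤ α) (hl : lm ≤ lp) {u : Fin K → ℝ}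
    {kstar k : Fin K} (hk : u k < u kstar) {s T : ℕ} (hsT : s < T) (hs : K ≤ s)
    (ha : action Γ l x s = k)
    (hc : 4 * α * Real.log T / (u kstar - u k) ^ 2 ≤ pulls Γ l x k s)
    (hmean : rewardSum Γ l x k s < (u k + (u kstar - u k) / 4) * pulls Γ l x k s) :
    rewardSum Γ l x kstar s ≤ (u kstar - (u kstar - u k) / 4) * pulls Γ l x kstar s := by
  have hΔ : 0 < u kstar - u k := sub_pos.2 hk
  have hbonus : α * Real.log ((s : ℝ) + 1) ≤ ((u kstar - u k) / 2) ^ 2 * pulls Γ l x k s := by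
    have h1 : α * Real.log ((s : ℝ) + 1) ≤ α * Real.log T := by
      have : (s : ℝ) + 1 ≤ T := by exact_mod_cast hsT
      gcongr
    rw [div_le_iff₀ (by positivity)] at hc
    linarith
  -- Of the gap, 1/2 is spent on the bonus and 1/4 on the error of arm `k`; the last 1/4 is the
  -- deviation forced on the best arm.
  have hidx := hΓ.ucbIndex_lt hα hl hs ha (by positivity) hbonus hmean kstar
  rw [show u k + (u kstar - u k) / 4 + (u kstar - u k) / 2 = u kstar - (u kstar - u k) / 4 by ring]
    at hidx
  exact rewardSum_le_of_ucbIndex_lt (hΓ.pulls_pos kstar hs) hidx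

lemma exists_expPulls_le {K : ℕ} {α ρ : ℝ} (hα : 2 < α) (hρ : 0 < ρ)
    {u : Fin K → ℝ} {kstar : Fin K} (hbest : ∀ k, k ≠ kstar → u k < u kstar)
    (k : Fin K) :
    ∃ B : ℝ, 0 ≤ B ∧
      ∀ {Ω : Type*} [MeasurableSpace Ω] (μ : Measure Ω) [IsProbabilityMeasure μ]
        (L : ℕ → Ω → ℝ) (X : Fin K → ℕ → Ω → ℝ) (lm lp : ℝ) (Γ : Policy K),
        IsOpportunisticBandit μ L X u → (∀ s, μ.real {ω | L s ω ≤ lm} = ρ) → lm ≤ lp →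
        IsAdaUCB α lm lp Γ → k ≠ kstar → ∀ T : ℕ,
        expPulls μ Γ L X k T ≤ 4 * α * Real.log T / (u kstar - u k) ^ 2 + B := by
  classical
  rcases eq_or_ne k kstar with hk | hk
  · exact ⟨0, le_rfl, fun _ _ _ _ _ _ _ _ _ _ _ hne => absurd hk hne⟩
  have hΔ : 0 < u kstar - u k := sub_pos.2 (hbest k hk)
  set Δ := u kstar - u k with hΔdef
  -- With 16/Δ² the exponent 2(Δ/4)² · (16/Δ²) log(s+1) equals 2 log(s+1), so the deviations of the
  -- best arm have summable probability (s+1)⁻².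
  obtain ⟨f, hf, hf0, hfP⟩ := exists_summable_measureReal_pulls_le hα hρ hbest
    (c := 16 / Δ ^ 2) (by positivity)
  have hg := summable_inv_succ_sq 1
  -- In order: rounding in the count of pulls up to the threshold, the `K` initial slots, deviations
  -- of arm `k`, deviations of the best arm, underexploration of the best arm.
  refine ⟨1 + K + (1 + (∑' s : ℕ, 1 / ((s : ℝ) + 1) ^ 2 + ∑' s, f s)), ?_, ?_⟩
  · have h1 : 0 ≤ ∑' s, f s := tsum_nonneg hf0
    have h2 : 0 ≤ ∑' s : ℕ, 1 / ((s : ℝ) + 1) ^ 2 := tsum_nonneg fun s => by positivity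
    positivity
  intro Ω _ μ _ L X lm lp Γ h hL hl hΓ _ T
  set c := 4 * α * Real.log T / Δ ^ 2 with hcdef
  have hα0 : 0 ≤ α := by linarith
  have hc : 0 ≤ c := by have := Real.log_natCast_nonneg T; positivity
  let C : Fin K → ℕ → Ω → ℝ := fun j s ω => pulls Γ (fun r => L r ω) (fun j r => X j r ω) j s
  let S : Fin K → ℕ → Ω → ℝ := fun j s ω => rewardSum Γ (fun r => L r ω) (fun j r => X j r ω) j s
  have hC : ∀ j s, Measurable (C j s) := fun j s =>
    measurable_from_top.comp ((measurable_pulls hΓ.measurable j s).comp h.measurable_path)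
  have hS : ∀ j s, Measurable (S j s) := fun j s =>
    (measurable_rewardSum hΓ.measurable j s).comp h.measurable_path
  let A : ℕ → Set Ω := fun s => {ω | c ≤ C k s ω ∧ (u k + Δ / 4) * C k s ω ≤ S k s ω}
  let D : ℕ → Set Ω := fun s => {ω | 16 / Δ ^ 2 * Real.log ((s : ℝ) + 1) ≤ C kstar s ω ∧
    S kstar s ω ≤ (u kstar - Δ / 4) * C kstar s ω}
  let E : ℕ → Set Ω := fun s => {ω | C kstar s ω ≤ 16 / Δ ^ 2 * Real.log ((s : ℝ) + 1)}
  let F : ℕ → Set Ω := fun s => A s ∪ (D s ∪ E s)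
  have hF : ∀ s, MeasurableSet (F s) := fun s =>
    ((measurableSet_le measurable_const (hC k s)).inter
      (measurableSet_le ((hC k s).const_mul _) (hS k s))).union
    (((measurableSet_le measurable_const (hC kstar s)).inter
      (measurableSet_le (hS kstar s) ((hC kstar s).const_mul _))).union
      (measurableSet_le (hC kstar s) measurable_const))
  have hFint : ∀ s, Integrable ((F s).indicator (1 : Ω → ℝ)) μ := fun s =>
    (integrable_const (1 : ℝ)).indicator (hF s)
  have hpath : ∀ ω, C k T ω ≤ (c + 1 + K) + ∑ s ∈ Finset.range T, (F s).indicator 1 ω := by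
    intro ω
    have hcover : ((Finset.range T).filter
          fun s => action Γ (fun r => L r ω) (fun j r => X j r ω) s = k) ⊆
        (((Finset.range T).filter fun s =>
          action Γ (fun r => L r ω) (fun j r => X j r ω) s = k ∧ C k s ω ≤ c) ∪
            Finset.range K) ∪ (Finset.range T).filter fun s => ω ∈ F s := by
      intro s hs
      obtain ⟨hsT, ha⟩ := Finset.mem_filter.1 hs
      by_cases h1 : C k s ω ≤ c
      · exact Finset.mem_union_left _ (Finset.mem_union_left _ (Finset.mem_filter.2 ⟨hsT, ha, h1⟩))
      by_cases h2 : s < K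
      · exact Finset.mem_union_left _ (Finset.mem_union_right _ (Finset.mem_range.2 h2))
      refine Finset.mem_union_right _ (Finset.mem_filter.2 ⟨hsT, ?_⟩)
      by_cases h3 : (u k + Δ / 4) * C k s ω ≤ S k s ω
      · exact Or.inl ⟨(not_le.1 h1).le, h3⟩
      by_cases h4 : C kstar s ω ≤ 16 / Δ ^ 2 * Real.log ((s : ℝ) + 1)
      · exact Or.inr (Or.inr h4)
      · exact Or.inr (Or.inl ⟨(not_le.1 h4).le, hΓ.rewardSum_le_of_action hα0 hl (hbest k hk)
          (Finset.mem_range.1 hsT) (not_lt.1 h2) ha (not_le.1 h1).le (not_le.1 h3)⟩)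
    have hcard := (Finset.card_le_card hcover).trans ((Finset.card_union_le _ _).trans
      (Nat.add_le_add_right (Finset.card_union_le _ _) _))
    have hcard' : C k T ω ≤ (((Finset.range T).filter fun s =>
          action Γ (fun r => L r ω) (fun j r => X j r ω) s = k ∧ C k s ω ≤ c).card : ℝ) + K +
          ((Finset.range T).filter fun s => ω ∈ F s).card := by
      rw [Finset.card_range] at hcard
      simp only [C, pulls]
      exact_mod_cast hcard
    have h5 : (((Finset.range T).filter fun s => ω ∈ F s).card : ℝ) =
        ∑ s ∈ Finset.range T, (F s).indicator 1 ω := by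
      rw [Finset.card_filter]
      push_cast
      exact Finset.sum_congr rfl fun s _ => by simp [Set.indicator_apply]
    have h6 := card_filter_pulls_le (Γ := Γ) (l := fun r => L r ω) (x := fun j r => X j r ω) k T hc
    rw [h5] at hcard'
    linarith
  -- The threshold contains log T rather than log s, so every slot has the same bound T^(-α/2) ≤
  -- 1/T, by α > 2, and the `T` slots together cost at most 1.
  have hAP : ∀ s, μ.real (A s) ≤ (T : ℝ)⁻¹ ∨ T = 0 := by
    intro s
    rcases Nat.eq_zero_or_pos T with hT | hT
    · exact Or.inr hT
    refine Or.inl ((h.measureReal_upper_tail_le hΓ.measurable k (by positivity) s).trans ?_)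
    have hT' : (0 : ℝ) < T := by exact_mod_cast hT
    rw [← Real.exp_log (inv_pos.2 hT'), Real.log_inv]
    refine Real.exp_le_exp.2 (neg_le_neg ?_)
    rw [hcdef, show 2 * (Δ / 4) ^ 2 * (4 * α * Real.log T / Δ ^ 2) = α / 2 * Real.log T by
      field_simp; ring]
    nlinarith [Real.log_natCast_nonneg T]
  have hAsum : ∑ s ∈ Finset.range T, μ.real (A s) ≤ 1 := by
    rcases Nat.eq_zero_or_pos T with hT | hT
    · simp [hT]
    refine (Finset.sum_le_card_nsmul _ _ _ fun s _ => (hAP s).resolve_right hT.ne').trans ?_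
    have hT' : (T : ℝ) ≠ 0 := by exact_mod_cast hT.ne'
    simp [hT']
  have hDP : ∀ s, μ.real (D s) ≤ 1 / ((s : ℝ) + 1) ^ 2 := by
    intro s
    refine (h.measureReal_lower_tail_le hΓ.measurable kstar (by positivity) s).trans
      (le_of_eq ?_)
    have hs : (0 : ℝ) < (s : ℝ) + 1 := by positivity
    rw [show 2 * (Δ / 4) ^ 2 * (16 / Δ ^ 2 * Real.log ((s : ℝ) + 1))
      = 2 * Real.log ((s : ℝ) + 1) by field_simp; norm_num]
    rw [one_div, ← Real.exp_log (show 0 < (((s : ℝ) + 1) ^ 2)⁻¹ by positivity), Real.log_inv,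
      Real.log_pow]
    norm_num
  calc expPulls μ Γ L X k T
      ≤ ∫ ω, (c + 1 + K) + ∑ s ∈ Finset.range T, (F s).indicator 1 ω ∂μ := by
        refine integral_mono_of_nonneg (Eventually.of_forall fun ω => Nat.cast_nonneg _) ?_
          (Eventually.of_forall hpath)
        exact (integrable_const _).add (integrable_finsetSum _ fun s _ => hFint s)
    _ = (c + 1 + K) + ∑ s ∈ Finset.range T, μ.real (F s) := by
        rw [integral_add (integrable_const _) (integrable_finsetSum _ fun s _ => hFint s),
          integral_finsetSum _ fun s _ => hFint s]
        simp [integral_indicator_one (hF _)]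
    _ ≤ (c + 1 + K) + ∑ s ∈ Finset.range T,
          (μ.real (A s) + (1 / ((s : ℝ) + 1) ^ 2 + f s)) := by
        gcongr with s hs
        refine (measureReal_union_le _ _).trans (add_le_add le_rfl
          ((measureReal_union_le _ _).trans (add_le_add (hDP s) ?_)))
        exact hfP μ L X lm lp Γ h hL hl hΓ s
    _ ≤ c + (1 + K + (1 + (∑' s : ℕ, 1 / ((s : ℝ) + 1) ^ 2 + ∑' s, f s))) := by
        rw [Finset.sum_add_distrib, Finset.sum_add_distrib]
        have h1 := hg.sum_le_tsum (Finset.range T) fun s _ => by positivity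
        have h2 := hf.sum_le_tsum (Finset.range T) fun s _ => hf0 s
        linarith

end OpportunisticBandit

theorem lemma5 {K : ℕ} (α ρ : ℝ) (hα : 2 < α) (hρ : 0 < ρ)
    (u : Fin K → ℝ) (kstar : Fin K) (hbest : ∀ k, k ≠ kstar → u k < u kstar) :
    -- the constant depends on `K`, `α`, `ρ` and the mean rewards only
    ∃ B : ℝ, ∀ {Ω : Type*} [MeasurableSpace Ω] (μ : Measure Ω) [IsProbabilityMeasure μ]
      (L : ℕ → Ω → ℝ) (X : Fin K → ℕ → Ω → ℝ) (lm lp : ℝ) (Γ : Policy K),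
      IsOpportunisticBandit μ L X u →
      (∀ s, μ.real {ω | L s ω ≤ lm} = ρ) →
      lm ≤ lp →
      IsAdaUCB α lm lp Γ →
      (∀ k, k ≠ kstar → ∀ T : ℕ,
        expPulls μ Γ L X k T ≤ 4 * α * Real.log T / (u kstar - u k) ^ 2 + B) ∧
      (fun T : ℕ => regret μ Γ L X u T) =O[atTop] (fun T : ℕ => Real.log T) := by
  choose B hB0 hB using exists_expPulls_le hα hρ hbest
  -- Each `B k` is nonnegative, so the sum is one constant valid for all arms.
  refine ⟨∑ k, B k, ?_⟩
  intro Ω _ μ _ L X lm lp Γ h hL hl hΓ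
  have hpulls : ∀ k, k ≠ kstar → ∀ T : ℕ,
      expPulls μ Γ L X k T ≤ 4 * α * Real.log T / (u kstar - u k) ^ 2 + ∑ k, B k :=
    fun k hk T => (hB k μ L X lm lp Γ h hL hl hΓ hk T).trans
      (by gcongr; exact Finset.single_le_sum (fun j _ => hB0 j) (Finset.mem_univ k))
  refine ⟨hpulls, ?_⟩
  have hbest' : ∀ k, u k ≤ u kstar := fun k => by
    by_cases hk : k = kstar
    · rw [hk]
    · exact (hbest k hk).le
  refine IsBigO.of_bound
    (∑ k, (u kstar - u k) * (4 * α / (u kstar - u k) ^ 2 + ∑ k, B k)) ?_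
  -- Once log T ≥ 1, the additive constant is absorbed into a multiple of log T.
  have hlarge : ∀ᶠ T : ℕ in atTop, 1 ≤ Real.log T :=
    (Real.tendsto_log_atTop.comp tendsto_natCast_atTop_atTop).eventually_ge_atTop 1
  filter_upwards [hlarge] with T hT
  obtain ⟨h0, h1⟩ := h.regret_mem_Icc hΓ.measurable hbest' T
  rw [Real.norm_of_nonneg h0, Real.norm_of_nonneg (by linarith), Finset.sum_mul]
  refine h1.trans (Finset.sum_le_sum fun k _ => ?_)
  by_cases hk : k = kstar
  · simp [hk]
  rw [mul_assoc]
  refine mul_le_mul_of_nonneg_left ((hpulls k hk T).trans ?_) (sub_nonneg.2 (hbest' k))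
  have hBs : 0 ≤ ∑ k, B k := Finset.sum_nonneg fun k _ => hB0 k
  rw [add_mul, div_mul_eq_mul_div]
  gcongr
  exact le_mul_of_one_le_right hBs hT
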